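/- Let $n,d\ge 0$ be integers, let $a_{0i}\in\mathbb{R}^{n}$ ($i=1,2,\dots$) be nonrandom vectors, let $A_0=A_0^{(m)}$ be the $m\times n$ matrix with rows $a_{01}^{\top},\dots,a_{0m}^{\top}$, and let $\tilde c_i=(\tilde c_{i1},\dots,\tilde c_{i,n+d})^{\top}$ ($i=1,2,\dots$) be random vectors in $\mathbb{R}^{n+d}$ on a common probability space. Assume: (i) the vectors $\tilde c_i$ are independent with zero mean and finite second moments; (ii) for a fixed set $J\subset\{1,\dots,n+d\}$, $\mathbf{E}\,\tilde c_{ij}^2=0$ for all $j\notin J$ and all $i\ge1$, and $\operatorname{cov}(\tilde c_{ij},\,j\in J)=\sigma^2\Sigma_i$ for all $i\ge1$, with $\sigma>0$ and matrices $\Sigma_i\in\mathbb{R}^{|J|\times|J|}$; (viii) for some $\delta>0$, $\sup_{i\ge1,\,j\in J}\mathbf{E}|\tilde c_{ij}|^{4+2\delta}<\infty$; (ix) for the same $\delta$, $m^{-(1+\delta/2)}\sum_{i=1}^m\|a_{0i}\|^{2+\delta}\to0$ as $m\to\infty$, where $\|\cdot\|$ is the Euclidean norm; (x) $\frac1m A_0^{\top}A_0\to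 V_A$ as $m\to\infty$, where $V_A$ is a nonsingular matrix; (xi) $\Sigma_i\to\Sigma_\infty$ as $i\to\infty$, for some matrix $\Sigma_\infty$; (xii) $\mathbf{E}\,\tilde c_{ip}\tilde c_{iq}\tilde c_{ir}=0$ for all $i\ge1$ and all (not necessarily distinct) $p,q,r\in J$; (xiii) for all (not necessarily distinct) $p,q,r,u\in J$, $\frac1m\sum_{i=1}^m\mathbf{E}\,\tilde c_{ip}\tilde c_{iq}\tilde c_{ir}\tilde c_{iu}$ converges to a finite limit $\mu_4(p,q,r,u)$ as $m\to\infty$. Put $S_i=\sigma^{-2}\operatorname{cov}(\tilde c_i)$ and $$W_i=\bigl(a_{0i}\tilde c_i^{\top},\ \tilde c_i\tilde c_i^{\top}-\sigma^2S_i\bigr)\in\mathbb{R}^{n\times(n+d)}\times\mathbb{R}^{(n+d)\times(n+d)}.$$ Then $$\frac1{\sqrt m}\sum_{i=1}^m W_i\ \xrightarrow{d}\ \Gamma=(\Gamma_1,\Gamma_2)\qquad\text{as } m\to\infty,$$ where $\Gamma$ is a centered (jointly) Gaussian random element of $\mathbb{R}^{n\times(n+d)}\times\mathbb{R}^{(n+d)\times(n+d)}$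 whose matrix components $\Gamma_1$ and $\Gamma_2$ are independent. -/

import Mathlib

open MeasureTheory ProbabilityTheory Filter Topology
open scoped Matrix

noncomputable section

/-- The Borel sigma-algebra on real matrices: the product sigma-algebra of the entries. -/
instance matrixMeasurableSpace {ι κ : Type*} : MeasurableSpace (Matrix ι κ ℝ) :=
  inferInstanceAs (MeasurableSpace (ι → κ → ℝ))

instance matrixBorelSpace {ι κ : Type*} [Countable ι] [Countable κ] :
    BorelSpace (Matrix ι κ ℝ) :=
  inferInstanceAs (BorelSpace (ι → κ → ℝ))

instance matrixSecondCountable {ι κ : Type*} [Countable ι] [Countable κ] :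
    SecondCountableTopology (Matrix ι κ ℝ) :=
  inferInstanceAs (SecondCountableTopology (ι → κ → ℝ))

/-- The covariance matrix of a random vector `x`, with entries `cov(x_j, x_k)`. -/
def covMatrix {Ω κ : Type*} [MeasurableSpace Ω] (P : Measure Ω) (x : Ω → κ → ℝ) :
    Matrix κ κ ℝ :=
  Matrix.of fun j k => cov[fun ω => x ω j, fun ω => x ω k; P]

/-- The true input matrix `A₀` with `m` rows `a₀₁ᵀ, …, a₀ₘᵀ` (the sequence is indexed from `0`). -/
def inputMatrix {n : ℕ} (a₀ : ℕ → EuclideanSpace ℝ (Fin n)) (m : ℕ) :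
    Matrix (Fin m) (Fin n) ℝ :=
  Matrix.of fun i j => a₀ i j

/-- `Sᵢ = σ⁻² cov(c̃ᵢ)`. -/
def normCov {Ω : Type*} [MeasurableSpace Ω] {N : ℕ} (P : Measure Ω) (σ : ℝ)
    (c : ℕ → Ω → Fin N → ℝ) (i : ℕ) : Matrix (Fin N) (Fin N) ℝ :=
  (1 / σ ^ 2) • covMatrix P (c i)

/-- The random couple of matrices `Wᵢ = (a₀ᵢ c̃ᵢᵀ, c̃ᵢ c̃ᵢᵀ - σ² Sᵢ)`. -/
def pairW {Ω : Type*} [MeasurableSpace Ω] {n N : ℕ} (P : Measure Ω) (σ : ℝ)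
    (a₀ : ℕ → EuclideanSpace ℝ (Fin n)) (c : ℕ → Ω → Fin N → ℝ) (i : ℕ) (ω : Ω) :
    Matrix (Fin n) (Fin N) ℝ × Matrix (Fin N) (Fin N) ℝ :=
  (Matrix.vecMulVec (fun k => a₀ i k) (c i ω),
    Matrix.vecMulVec (c i ω) (c i ω) - σ ^ 2 • normCov P σ c i)

end

/-! ### Scalar triangular arrays: Lyapunov's condition and characteristic functions. -/

section Lyapunov

/-! List the entries of `pairW` as one Euclidean vector. These vectors are independent and centered,
so a vector Lyapunov theorem, `tendstoInDistribution_one_div_sqrt_smul_sum`, gives a Gaussian limit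
once the averaged covariances converge and the moments of order `2 + δ` are negligible. The limit is
carried back to couples of matrices by a continuous linear map.

The covariances fall into blocks (`exists_tendsto_average_covariance_pairEntries`). Within the
linear block they are input products times second error moments, handled by a weighted Cesàro
argument. Within the quadratic block they are fourth moments minus products of second moments.
Across the blocks they vanish, because first and third moments do. The limiting covariance is
therefore block diagonal, and jointly Gaussian uncorrelated blocks are independent: this is where
the independence of the two components comes from.

Negligibility (`tendsto_lyapunov_pairEntries`) uses the input condition for the linear block and the
`4 + 2δ` moments for the quadratic one. The vector theorem reduces, by projecting on each direction,
to an estimate of products of scalar characteristic functions. Error-free coordinates vanish almost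
everywhere, so assumptions on `J` extend to all coordinates. -/

lemma sq_le_rpow_mul_abs_rpow {ε δ x : ℝ} (hε : 0 < ε) (hδ : 0 < δ) (hx : ε ≤ |x|) :
    x ^ 2 ≤ ε ^ (-δ) * |x| ^ (2 + δ) := by
  have hx0 : 0 < |x| := hε.trans_le hx
  have h1 : ε ^ δ ≤ |x| ^ δ := Real.rpow_le_rpow hε.le hx hδ.le
  rw [Real.rpow_neg hε.le, Real.rpow_add hx0, Real.rpow_two, sq_abs, inv_mul_eq_div,
    le_div_iff₀ (by positivity)]
  exact mul_le_mul_of_nonneg_left h1 (sq_nonneg x)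

/-- Below `ε` the cubic Taylor remainder is at most `ε x²`. Above `ε` the error is at most `4 x²`,
and `x²` is absorbed by `ε ^ (-δ) * |x| ^ (2 + δ)`. Truncating at `ε` makes any `δ > 0` admissible.
-/
lemma norm_exp_mul_I_sub_taylor_le {ε δ : ℝ} (hε : 0 < ε) (hε1 : ε ≤ 1) (hδ : 0 < δ) (x : ℝ) :
    ‖Complex.exp (x * Complex.I) - (1 + x * Complex.I - x ^ 2 / 2)‖ ≤
      4 * (ε * x ^ 2 + ε ^ (-δ) * |x| ^ (2 + δ)) := by
  have hnorm : ‖(x : ℂ) * Complex.I‖ = |x| := by simp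
  have hnn : 0 ≤ ε ^ (-δ) * |x| ^ (2 + δ) := by positivity
  have hcub (h1 : |x| ≤ 1) :
      ‖Complex.exp (x * Complex.I) - (1 + x * Complex.I - x ^ 2 / 2)‖ ≤ |x| ^ 3 := by
    have := Complex.exp_bound (x := x * Complex.I) (by rwa [hnorm]) (n := 3) (by norm_num)
    rw [hnorm] at this
    have hs : ∑ m ∈ Finset.range 3, (x * Complex.I) ^ m / (m.factorial : ℂ) =
        1 + x * Complex.I - x ^ 2 / 2 := by
      simp [Finset.sum_range_succ, mul_pow, Nat.factorial]
      ring
    rw [hs] at this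
    refine this.trans (mul_le_of_le_one_right (by positivity) ?_)
    norm_num [Nat.factorial]
  rcases le_or_gt |x| ε with h | h
  · refine (hcub (h.trans hε1)).trans ?_
    have : |x| ^ 3 ≤ ε * x ^ 2 := by
      rw [pow_succ, sq_abs, mul_comm]
      exact mul_le_mul_of_nonneg_right h (sq_nonneg x)
    have : 0 ≤ ε * x ^ 2 := by positivity
    linarith
  · have hsq := sq_le_rpow_mul_abs_rpow hε hδ h.le
    have h0 : 0 ≤ ε * x ^ 2 := by positivity
    suffices ‖Complex.exp (x * Complex.I) - (1 + x * Complex.I - x ^ 2 / 2)‖ ≤ 4 * x ^ 2 by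
      linarith
    rcases le_or_gt |x| 1 with h1 | h1
    · refine (hcub h1).trans ?_
      rw [pow_succ, sq_abs]
      nlinarith [sq_nonneg x]
    · have he : ‖Complex.exp (x * Complex.I)‖ = 1 := Complex.norm_exp_ofReal_mul_I x
      have h2 : ‖(x : ℂ) ^ 2 / 2‖ = x ^ 2 / 2 := by simp
      have : ‖(1 + x * Complex.I - x ^ 2 / 2 : ℂ)‖ ≤ 1 + |x| + x ^ 2 / 2 := by
        refine (norm_sub_le _ _).trans ?_
        rw [h2]
        gcongr
        refine (norm_add_le _ _).trans ?_
        rw [hnorm, norm_one]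
      refine (norm_sub_le _ _).trans ?_
      rw [he]
      nlinarith [sq_abs x]

/-- The nontrivial side is `exp (-u) ≤ 1 / (1 + u) ≤ 1 - u + u²`, the last step because `(1 - u +
u²)(1 + u) = 1 + u³`. -/
lemma abs_one_sub_sub_exp_neg_le {u : ℝ} (hu : 0 ≤ u) : |1 - u - Real.exp (-u)| ≤ u ^ 2 := by
  have h1 : 1 - u ≤ Real.exp (-u) := by linarith [Real.add_one_le_exp (-u)]
  have h2 : Real.exp (-u) * (1 + u) ≤ 1 := by
    calc Real.exp (-u) * (1 + u) ≤ Real.exp (-u) * Real.exp u := by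
          gcongr; linarith [Real.add_one_le_exp u]
      _ = 1 := by rw [← Real.exp_add]; simp
  rw [abs_le]
  have : 0 ≤ Real.exp (-u) := (Real.exp_pos _).le
  constructor
  · have h3 : 1 ≤ (1 - u + u ^ 2) * (1 + u) := by nlinarith [pow_nonneg hu 3]
    have h4 : Real.exp (-u) ≤ 1 - u + u ^ 2 :=
      le_of_mul_le_mul_right (h2.trans h3) (by linarith)
    linarith
  · nlinarith

/-- Telescoping: factors are exchanged one at a time, and those not being exchanged lie in the unit
disc. -/
lemma norm_prod_sub_prod_le_sum {ι : Type*} (s : Finset ι) {z w : ι → ℂ}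
    (hz : ∀ i ∈ s, ‖z i‖ ≤ 1) (hw : ∀ i ∈ s, ‖w i‖ ≤ 1) :
    ‖∏ i ∈ s, z i - ∏ i ∈ s, w i‖ ≤ ∑ i ∈ s, ‖z i - w i‖ := by
  classical
  induction s using Finset.induction_on with
  | empty => simp
  | insert a s ha ih =>
    rw [Finset.prod_insert ha, Finset.prod_insert ha, Finset.sum_insert ha]
    have ih := ih (fun i hi => hz i (Finset.mem_insert_of_mem hi))
      (fun i hi => hw i (Finset.mem_insert_of_mem hi))
    have hp : ‖∏ i ∈ s, z i‖ ≤ 1 := by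
      rw [norm_prod]
      exact Finset.prod_le_one (fun _ _ => norm_nonneg _)
        (fun i hi => hz i (Finset.mem_insert_of_mem hi))
    have hwa := hw a (Finset.mem_insert_self a s)
    calc ‖z a * ∏ i ∈ s, z i - w a * ∏ i ∈ s, w i‖
        = ‖(z a - w a) * ∏ i ∈ s, z i + w a * (∏ i ∈ s, z i - ∏ i ∈ s, w i)‖ := by ring_nf
      _ ≤ ‖z a - w a‖ * 1 + 1 * ‖∏ i ∈ s, z i - ∏ i ∈ s, w i‖ := by
        refine (norm_add_le _ _).trans ?_
        rw [norm_mul, norm_mul]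
        gcongr
      _ ≤ _ := by linarith

variable {Ω : Type*} [MeasurableSpace Ω] {P : Measure Ω}

lemma memLp_of_integrable_abs_rpow {r : ℝ} (hr : 0 < r) {X : Ω → ℝ}
    (hX : AEStronglyMeasurable X P) (h : Integrable (fun ω => |X ω| ^ r) P) :
    MemLp X (ENNReal.ofReal r) P := by
  rw [← integrable_norm_rpow_iff hX (by simpa using hr) ENNReal.ofReal_ne_top]
  simpa [ENNReal.toReal_ofReal hr.le] using h

lemma integrable_abs_rpow_of_memLp {r : ℝ} (hr : 0 < r) {X : Ω → ℝ}
    (hX : MemLp X (ENNReal.ofReal r) P) : Integrable (fun ω => |X ω| ^ r) P := by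
  simpa [ENNReal.toReal_ofReal hr.le] using
    hX.integrable_norm_rpow (by simpa using hr) ENNReal.ofReal_ne_top

variable [IsProbabilityMeasure P]

lemma memLp_of_integrable_abs_rpow_of_le {r : ℝ} {k : ℕ} (hr : 0 < r) (hk : (k : ℝ) ≤ r)
    {X : Ω → ℝ} (hX : AEStronglyMeasurable X P) (h : Integrable (fun ω => |X ω| ^ r) P) :
    MemLp X k P :=
  (memLp_of_integrable_abs_rpow hr hX h).mono_exponent
    (by rw [← ENNReal.ofReal_natCast]; exact ENNReal.ofReal_le_ofReal hk)

/-- The characteristic function of a centered variable at `1` is close to that of the Gaussian with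
the same variance. -/
lemma norm_integral_exp_mul_I_sub_le {ε δ : ℝ} (hε : 0 < ε) (hε1 : ε ≤ 1) (hδ : 0 < δ) {X : Ω → ℝ}
    (hX : AEStronglyMeasurable X P) (hint : Integrable (fun ω => |X ω| ^ (2 + δ)) P)
    (hmean : ∫ ω, X ω ∂P = 0) :
    ‖∫ ω, Complex.exp (X ω * Complex.I) ∂P - Real.exp (-((∫ ω, X ω ^ 2 ∂P) / 2))‖ ≤
      4 * (ε * ∫ ω, X ω ^ 2 ∂P + ε ^ (-δ) * ∫ ω, |X ω| ^ (2 + δ) ∂P) +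
      (∫ ω, X ω ^ 2 ∂P) * (ε ^ 2 + ε ^ (-δ) * ∫ ω, |X ω| ^ (2 + δ) ∂P) := by
  have h2 : MemLp X 2 P := by
    exact_mod_cast memLp_of_integrable_abs_rpow_of_le (k := 2) (by positivity)
      (by push_cast; linarith) hX hint
  have hsq := h2.integrable_sq
  have hX1 : Integrable X P := h2.integrable (by norm_num)
  set s := ∫ ω, X ω ^ 2 ∂P with hs
  set L := ∫ ω, |X ω| ^ (2 + δ) ∂P with hL
  have hs0 : 0 ≤ s := integral_nonneg fun ω => sq_nonneg _
  have hexp : Integrable (fun ω => Complex.exp (X ω * Complex.I)) P := by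
    refine Integrable.of_bound (C := 1) ?_ (ae_of_all _ fun ω => ?_)
    · exact Complex.continuous_exp.comp_aestronglyMeasurable
        ((Complex.continuous_ofReal.comp_aestronglyMeasurable hX).mul_const _)
    · rw [Complex.norm_exp_ofReal_mul_I]
  have hpol1 : Integrable (fun ω => (1 : ℂ) + X ω * Complex.I) P :=
    (integrable_const _).add (hX1.ofReal.mul_const _)
  have hpol2 : Integrable (fun ω => (X ω : ℂ) ^ 2 / 2) P := by
    have := (hsq.ofReal (𝕜 := ℂ)).div_const 2
    simpa using this
  have hval : ∫ ω, ((1 : ℂ) + X ω * Complex.I - (X ω : ℂ) ^ 2 / 2) ∂P = ((1 - s / 2 : ℝ) : ℂ) := by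
    rw [integral_sub hpol1 hpol2, integral_add (integrable_const _) (hX1.ofReal.mul_const _),
      integral_mul_const, integral_div, integral_complex_ofReal, hmean]
    have : ∫ ω, (X ω : ℂ) ^ 2 ∂P = (s : ℂ) := by
      rw [hs, ← integral_complex_ofReal]; simp
    rw [this]; simp
  have hA : ‖∫ ω, Complex.exp (X ω * Complex.I) ∂P - ((1 - s / 2 : ℝ) : ℂ)‖ ≤
      4 * (ε * s + ε ^ (-δ) * L) := by
    have hpol : Integrable (fun ω => (1 : ℂ) + X ω * Complex.I - (X ω : ℂ) ^ 2 / 2) P :=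
      hpol1.sub hpol2
    rw [← hval, ← integral_sub hexp hpol]
    calc _ ≤ ∫ ω, 4 * (ε * X ω ^ 2 + ε ^ (-δ) * |X ω| ^ (2 + δ)) ∂P :=
          norm_integral_le_of_norm_le
            (((hsq.const_mul ε).add (hint.const_mul _)).const_mul 4)
            (ae_of_all _ fun ω => norm_exp_mul_I_sub_taylor_le hε hε1 hδ (X ω))
      _ = _ := by
        rw [integral_const_mul, integral_add (hsq.const_mul ε) (hint.const_mul _),
          integral_const_mul, integral_const_mul]
  -- The error in replacing `1 - s / 2` by the exponential is quadratic in `s`. Bounding one of the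
  -- two factors `s` by a small quantity leaves an error linear in `s`, which can be summed along a
  -- row of the array.
  have hsle : s ≤ ε ^ 2 + ε ^ (-δ) * L := by
    calc s ≤ ∫ ω, (ε ^ 2 + ε ^ (-δ) * |X ω| ^ (2 + δ)) ∂P := by
          refine integral_mono hsq ((integrable_const _).add (hint.const_mul _)) fun ω => ?_
          have hnn : 0 ≤ ε ^ (-δ) * |X ω| ^ (2 + δ) := by positivity
          rcases le_or_gt ε |X ω| with h | h
          · have := sq_le_rpow_mul_abs_rpow hε hδ h
            have := sq_nonneg ε
            simp only; linarith
          · have : X ω ^ 2 ≤ ε ^ 2 := by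
              rw [← sq_abs (X ω)]; gcongr
            simp only; linarith
      _ = _ := by
        rw [integral_add (integrable_const _) (hint.const_mul _), integral_const_mul]
        simp [hL]
  have hB : ‖((1 - s / 2 : ℝ) : ℂ) - (Real.exp (-(s / 2)) : ℝ)‖ ≤
      s * (ε ^ 2 + ε ^ (-δ) * L) := by
    rw [← Complex.ofReal_sub, Complex.norm_real, Real.norm_eq_abs]
    refine (abs_one_sub_sub_exp_neg_le (u := s / 2) (by positivity)).trans ?_
    nlinarith [mul_le_mul_of_nonneg_left hsle hs0]
  calc _ = ‖(∫ ω, Complex.exp (X ω * Complex.I) ∂P - ((1 - s / 2 : ℝ) : ℂ)) +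
        (((1 - s / 2 : ℝ) : ℂ) - (Real.exp (-(s / 2)) : ℝ))‖ := by congr 1; ring
    _ ≤ _ := (norm_add_le _ _).trans (add_le_add hA hB)

/-- Lyapunov's condition for a triangular array of centered variables forces the product of the
characteristic functions to converge to that of a centered Gaussian. -/
lemma tendsto_prod_integral_exp_mul_I {δ v : ℝ} (hδ : 0 < δ) {X : ℕ → ℕ → Ω → ℝ}
    (hX : ∀ m i, AEStronglyMeasurable (X m i) P)
    (hint : ∀ m i, Integrable (fun ω => |X m i ω| ^ (2 + δ)) P)
    (hmean : ∀ m i, ∫ ω, X m i ω ∂P = 0)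
    (hvar : Tendsto (fun m => ∑ i ∈ Finset.range m, ∫ ω, X m i ω ^ 2 ∂P) atTop (𝓝 v))
    (hLyap : Tendsto (fun m => ∑ i ∈ Finset.range m, ∫ ω, |X m i ω| ^ (2 + δ) ∂P) atTop (𝓝 0)) :
    Tendsto (fun m => ∏ i ∈ Finset.range m, ∫ ω, Complex.exp (X m i ω * Complex.I) ∂P) atTop
      (𝓝 (Real.exp (-(v / 2)) : ℝ)) := by
  set V : ℕ → ℝ := fun m => ∑ i ∈ Finset.range m, ∫ ω, X m i ω ^ 2 ∂P with hV
  set L : ℕ → ℝ := fun m => ∑ i ∈ Finset.range m, ∫ ω, |X m i ω| ^ (2 + δ) ∂P with hL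
  have hs0 (m i : ℕ) : 0 ≤ ∫ ω, X m i ω ^ 2 ∂P := integral_nonneg fun ω => sq_nonneg _
  have hl0 (m i : ℕ) : 0 ≤ ∫ ω, |X m i ω| ^ (2 + δ) ∂P := integral_nonneg fun ω => by positivity
  have hexp : Tendsto (fun m => ((Real.exp (-(V m / 2)) : ℝ) : ℂ)) atTop
      (𝓝 (Real.exp (-(v / 2)) : ℝ)) :=
    (Complex.continuous_ofReal.tendsto _).comp
      ((Real.continuous_exp.tendsto _).comp (hvar.div_const 2).neg)
  have hbound (ε : ℝ) (hε : 0 < ε) (hε1 : ε ≤ 1) (m : ℕ) :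
      ‖∏ i ∈ Finset.range m, ∫ ω, Complex.exp (X m i ω * Complex.I) ∂P -
        ((Real.exp (-(V m / 2)) : ℝ) : ℂ)‖ ≤
      4 * (ε * V m + ε ^ (-δ) * L m) + V m * (ε ^ 2 + ε ^ (-δ) * L m) := by
    have hprod : ((Real.exp (-(V m / 2)) : ℝ) : ℂ) =
        ∏ i ∈ Finset.range m, ((Real.exp (-((∫ ω, X m i ω ^ 2 ∂P) / 2)) : ℝ) : ℂ) := by
      rw [← Complex.ofReal_prod, ← Real.exp_sum, hV, Finset.sum_neg_distrib, Finset.sum_div]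
    rw [hprod]
    refine (norm_prod_sub_prod_le_sum _ (fun i _ => ?_) (fun i _ => ?_)).trans ?_
    · refine (norm_integral_le_of_norm_le_const (C := 1) (ae_of_all _ fun ω => ?_)).trans (by simp)
      rw [Complex.norm_exp_ofReal_mul_I]
    · rw [Complex.norm_real, Real.norm_eq_abs, abs_of_pos (Real.exp_pos _), Real.exp_le_one_iff]
      linarith [hs0 m i]
    · calc _ ≤ ∑ i ∈ Finset.range m,
            (4 * (ε * ∫ ω, X m i ω ^ 2 ∂P + ε ^ (-δ) * ∫ ω, |X m i ω| ^ (2 + δ) ∂P) +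
              (∫ ω, X m i ω ^ 2 ∂P) * (ε ^ 2 + ε ^ (-δ) * L m)) := by
            refine Finset.sum_le_sum fun i hi => ?_
            refine (norm_integral_exp_mul_I_sub_le hε hε1 hδ (hX m i) (hint m i)
              (hmean m i)).trans ?_
            -- A single moment is replaced by the row total `L m`, so that this factor comes out of
            -- the sum over `i`.
            have hle := Finset.single_le_sum (fun j _ => hl0 m j) hi
            have := hs0 m i
            gcongr
        _ = _ := by
          rw [Finset.sum_add_distrib, ← Finset.mul_sum, Finset.sum_add_distrib, ← Finset.mul_sum,
            ← Finset.mul_sum, ← Finset.sum_mul]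
  have hdiff : Tendsto (fun m => ∏ i ∈ Finset.range m, ∫ ω, Complex.exp (X m i ω * Complex.I) ∂P -
      ((Real.exp (-(V m / 2)) : ℝ) : ℂ)) atTop (𝓝 0) := by
    rw [tendsto_zero_iff_norm_tendsto_zero, Metric.tendsto_atTop']
    intro η hη
    -- Order of limits: for fixed `ε`, letting `m → ∞` removes `L m` and leaves `4 ε v + v ε²`.
    -- Hence `ε` is first chosen to make this smaller than `η`, and only then `m` is taken large.
    have hcont : Tendsto (fun ε : ℝ => 4 * (ε * v + 0) + v * (ε ^ 2 + 0)) (𝓝[>] 0) (𝓝 0) := by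
      refine (Continuous.tendsto' (by fun_prop) _ _ (by simp)).mono_left nhdsWithin_le_nhds
    obtain ⟨ε, hεη, hε, hε1⟩ := ((hcont.eventually_lt_const hη).and
      ((eventually_mem_nhdsWithin).and (nhdsWithin_le_nhds (Iic_mem_nhds one_pos)))).exists
    have hlim : Tendsto (fun m => 4 * (ε * V m + ε ^ (-δ) * L m) +
        V m * (ε ^ 2 + ε ^ (-δ) * L m)) atTop (𝓝 (4 * (ε * v + 0) + v * (ε ^ 2 + 0))) := by
      have h0 : Tendsto (fun m => ε ^ (-δ) * L m) atTop (𝓝 0) := by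
        simpa using hLyap.const_mul (ε ^ (-δ))
      exact (((hvar.const_mul ε).add h0).const_mul 4).add (hvar.mul (h0.const_add _))
    obtain ⟨N, hN⟩ := eventually_atTop.1 (hlim.eventually_lt_const hεη)
    refine ⟨N, fun m hm => ?_⟩
    rw [Real.dist_eq, sub_zero, abs_of_nonneg (norm_nonneg _)]
    exact (hbound ε hε hε1 m).trans_lt (hN m hm.le)
  simpa using hdiff.add hexp

end Lyapunov

/-! ### From scalar arrays to random vectors, by projection. -/

section VectorCLT

/-- Convexity of `x ↦ x ^ r` (the power mean inequality); it allows Lyapunov's condition to be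
checked coordinate by coordinate. -/
lemma abs_sum_mul_rpow_le {ι : Type*} [Fintype ι] {r : ℝ} (hr : 1 ≤ r) (t x : ι → ℝ) :
    |∑ k, t k * x k| ^ r ≤
      (Fintype.card ι : ℝ) ^ (r - 1) * ∑ k, |t k| ^ r * |x k| ^ r := by
  calc |∑ k, t k * x k| ^ r ≤ (∑ k, |t k * x k|) ^ r :=
        Real.rpow_le_rpow (abs_nonneg _) (Finset.abs_sum_le_sum_abs _ _) (by linarith)
    _ ≤ _ := Real.rpow_sum_le_const_mul_sum_rpow Finset.univ (fun k => t k * x k) hr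
    _ = _ := by simp [abs_mul, Real.mul_rpow (abs_nonneg _) (abs_nonneg _)]

lemma one_div_sqrt_natCast_rpow (δ : ℝ) (m : ℕ) :
    (1 / √(m : ℝ)) ^ (2 + δ) = 1 / (m : ℝ) ^ (1 + δ / 2) := by
  have hm : (0 : ℝ) ≤ m := m.cast_nonneg
  rw [one_div, one_div, Real.inv_rpow (Real.sqrt_nonneg _), Real.sqrt_eq_rpow, ← Real.rpow_mul hm]
  congr 2
  ring

variable {Ω : Type*} [MeasurableSpace Ω] {P : Measure Ω}
  {ι : Type*} [Fintype ι]

lemma integral_sum_mul_sq {X : ι → Ω → ℝ} (hX : ∀ k, MemLp (X k) 2 P) (t : ι → ℝ) :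
    ∫ ω, (∑ k, t k * X k ω) ^ 2 ∂P = ∑ k, ∑ l, t k * t l * ∫ ω, X k ω * X l ω ∂P := by
  have hint (k l : ι) : Integrable (fun ω => t k * t l * (X k ω * X l ω)) P :=
    ((hX k).integrable_mul (hX l)).const_mul _
  calc _ = ∫ ω, ∑ k, ∑ l, t k * t l * (X k ω * X l ω) ∂P := by
        congr with ω
        rw [sq, Finset.sum_mul_sum]
        exact Finset.sum_congr rfl fun k _ => Finset.sum_congr rfl fun l _ => by ring
    _ = _ := by
      rw [integral_finsetSum _ fun k _ => integrable_finsetSum _ fun l _ => hint k l]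
      refine Finset.sum_congr rfl fun k _ => ?_
      rw [integral_finsetSum _ fun l _ => hint k l]
      exact Finset.sum_congr rfl fun l _ => integral_const_mul _ _

variable {X : ℕ → Ω → ι → ℝ} {S : Matrix ι ι ℝ}

lemma tendsto_sum_integral_sum_mul_sq (hX : ∀ i k, MemLp (fun ω => X i ω k) 2 P)
    (hS : ∀ k l, Tendsto (fun m : ℕ =>
      (1 / (m : ℝ)) * ∑ i ∈ Finset.range m, ∫ ω, X i ω k * X i ω l ∂P) atTop (𝓝 (S k l)))
    (t : ι → ℝ) :
    Tendsto (fun m : ℕ =>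
      ∑ i ∈ Finset.range m, ∫ ω, (1 / √(m : ℝ) * ∑ k, t k * X i ω k) ^ 2 ∂P) atTop
      (𝓝 (t ⬝ᵥ S *ᵥ t)) := by
  have heq (m : ℕ) : ∑ i ∈ Finset.range m, ∫ ω, (1 / √(m : ℝ) * ∑ k, t k * X i ω k) ^ 2 ∂P =
      ∑ k, ∑ l, t k * t l *
        ((1 / (m : ℝ)) * ∑ i ∈ Finset.range m, ∫ ω, X i ω k * X i ω l ∂P) := by
    simp_rw [mul_pow, integral_const_mul, one_div, inv_pow, Real.sq_sqrt (Nat.cast_nonneg m),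
      integral_sum_mul_sq (hX _) t, Finset.mul_sum]
    rw [Finset.sum_comm]
    refine Finset.sum_congr rfl fun k _ => ?_
    rw [Finset.sum_comm]
    exact Finset.sum_congr rfl fun l _ => Finset.sum_congr rfl fun i _ => by ring
  have hlim : t ⬝ᵥ S *ᵥ t = ∑ k, ∑ l, t k * t l * S k l := by
    simp only [dotProduct, Matrix.mulVec, Finset.mul_sum]
    exact Finset.sum_congr rfl fun k _ => Finset.sum_congr rfl fun l _ => by ring
  simp_rw [heq, hlim]
  exact tendsto_finsetSum _ fun k _ => tendsto_finsetSum _ fun l _ => (hS k l).const_mul _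

/-- The quadratic form of `S` is a limit of sums of second moments. Positivity is needed for the
characteristic function of `multivariateGaussian 0 S` to be the expected one. -/
lemma posSemidef_of_tendsto_average (hX : ∀ i k, MemLp (fun ω => X i ω k) 2 P)
    (hS : ∀ k l, Tendsto (fun m : ℕ =>
      (1 / (m : ℝ)) * ∑ i ∈ Finset.range m, ∫ ω, X i ω k * X i ω l ∂P) atTop (𝓝 (S k l))) :
    S.PosSemidef := by
  refine .of_dotProduct_mulVec_nonneg ?_ fun t => ?_
  · ext k l
    refine tendsto_nhds_unique (hS l k) ?_
    simpa only [mul_comm] using hS k l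
  · refine ge_of_tendsto' (tendsto_sum_integral_sum_mul_sq hX hS t) fun m => ?_
    exact Finset.sum_nonneg fun i _ => integral_nonneg fun ω => sq_nonneg _

lemma tendsto_sum_integral_abs_sum_mul_rpow {δ : ℝ} (hδ : 0 < δ)
    (hX : ∀ i k, MemLp (fun ω => X i ω k) (ENNReal.ofReal (2 + δ)) P)
    (hLyap : ∀ k, Tendsto (fun m : ℕ => (1 / (m : ℝ) ^ (1 + δ / 2)) *
      ∑ i ∈ Finset.range m, ∫ ω, |X i ω k| ^ (2 + δ) ∂P) atTop (𝓝 0)) (t : ι → ℝ) :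
    Tendsto (fun m : ℕ =>
      ∑ i ∈ Finset.range m, ∫ ω, |1 / √(m : ℝ) * ∑ k, t k * X i ω k| ^ (2 + δ) ∂P) atTop
      (𝓝 0) := by
  have hr : 0 < 2 + δ := by linarith
  have hint (i : ℕ) (k : ι) := integrable_abs_rpow_of_memLp hr (hX i k)
  have hbound (m : ℕ) :
      ∑ i ∈ Finset.range m, ∫ ω, |1 / √(m : ℝ) * ∑ k, t k * X i ω k| ^ (2 + δ) ∂P ≤
      (Fintype.card ι : ℝ) ^ (2 + δ - 1) * ∑ k, |t k| ^ (2 + δ) *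
        ((1 / (m : ℝ) ^ (1 + δ / 2)) *
          ∑ i ∈ Finset.range m, ∫ ω, |X i ω k| ^ (2 + δ) ∂P) := by
    have hterm (i : ℕ) : ∫ ω, |1 / √(m : ℝ) * ∑ k, t k * X i ω k| ^ (2 + δ) ∂P ≤
        (1 / (m : ℝ) ^ (1 + δ / 2)) * ((Fintype.card ι : ℝ) ^ (2 + δ - 1) *
          ∑ k, |t k| ^ (2 + δ) * ∫ ω, |X i ω k| ^ (2 + δ) ∂P) := by
      have hsum : Integrable (fun ω => ∑ k, |t k| ^ (2 + δ) * |X i ω k| ^ (2 + δ)) P :=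
        integrable_finsetSum _ fun k _ => (hint i k).const_mul _
      have habs (ω : Ω) : |1 / √(m : ℝ) * ∑ k, t k * X i ω k| ^ (2 + δ) =
          (1 / (m : ℝ) ^ (1 + δ / 2)) * |∑ k, t k * X i ω k| ^ (2 + δ) := by
        rw [abs_mul, abs_of_nonneg (a := 1 / √(m : ℝ)) (by positivity),
          Real.mul_rpow (by positivity) (abs_nonneg _), one_div_sqrt_natCast_rpow]
      simp_rw [habs, integral_const_mul]
      gcongr
      calc _ ≤ ∫ ω, (Fintype.card ι : ℝ) ^ (2 + δ - 1) *
              ∑ k, |t k| ^ (2 + δ) * |X i ω k| ^ (2 + δ) ∂P := by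
            refine integral_mono_of_nonneg (ae_of_all _ fun ω => by positivity)
              (hsum.const_mul _) (ae_of_all _ fun ω => ?_)
            exact abs_sum_mul_rpow_le (by linarith) t (X i ω)
        _ = _ := by
          rw [integral_const_mul, integral_finsetSum _ fun k _ => (hint i k).const_mul _]
          simp_rw [integral_const_mul]
    refine (Finset.sum_le_sum fun i _ => hterm i).trans_eq ?_
    simp_rw [Finset.mul_sum]
    rw [Finset.sum_comm]
    exact Finset.sum_congr rfl fun k _ => Finset.sum_congr rfl fun i _ => by ring
  refine squeeze_zero (fun m => Finset.sum_nonneg fun i _ => integral_nonneg fun ω => by positivity)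
    hbound ?_
  have := (tendsto_finsetSum Finset.univ fun k _ =>
    (hLyap k).const_mul (|t k| ^ (2 + δ))).const_mul ((Fintype.card ι : ℝ) ^ (2 + δ - 1))
  simpa using this

/-- **Lyapunov's central limit theorem** for independent centered random vectors whose averaged
covariance matrices converge. -/
theorem tendstoInDistribution_one_div_sqrt_smul_sum [IsProbabilityMeasure P] [DecidableEq ι]
    {Ω' : Type*} [MeasurableSpace Ω'] {P' : Measure Ω'} [IsProbabilityMeasure P'] {δ : ℝ} (hδ : 0 < δ)
    {X : ℕ → Ω → EuclideanSpace ℝ ι} {Y : Ω' → EuclideanSpace ℝ ι}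
    (hindep : iIndepFun X P) (hmeas : ∀ i, AEMeasurable (X i) P)
    (hX : ∀ i k, MemLp (fun ω => X i ω k) (ENNReal.ofReal (2 + δ)) P)
    (hmean : ∀ i k, ∫ ω, X i ω k ∂P = 0)
    (hS : ∀ k l, Tendsto (fun m : ℕ =>
      (1 / (m : ℝ)) * ∑ i ∈ Finset.range m, ∫ ω, X i ω k * X i ω l ∂P) atTop (𝓝 (S k l)))
    (hLyap : ∀ k, Tendsto (fun m : ℕ => (1 / (m : ℝ) ^ (1 + δ / 2)) *
      ∑ i ∈ Finset.range m, ∫ ω, |X i ω k| ^ (2 + δ) ∂P) atTop (𝓝 0))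
    (hY : HasLaw Y (multivariateGaussian 0 S) P') :
    TendstoInDistribution (fun (m : ℕ) ω => (1 / √(m : ℝ)) • ∑ i ∈ Finset.range m, X i ω) atTop Y
      (fun _ => P) P' where
  forall_aemeasurable m := (Finset.aemeasurable_fun_sum _ fun i _ => hmeas i).fun_const_smul _
  aemeasurable_limit := hY.aemeasurable
  tendsto := by
    have hr : 0 < 2 + δ := by linarith
    have hX2 (i : ℕ) (k : ι) : MemLp (fun ω => X i ω k) 2 P := by
      refine (hX i k).mono_exponent ?_
      rw [← ENNReal.ofReal_ofNat]
      exact ENNReal.ofReal_le_ofReal (by linarith)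
    have hpos : S.PosSemidef :=
      posSemidef_of_tendsto_average (X := fun i ω => (X i ω).ofLp) hX2 hS
    -- By Lévy's theorem it suffices to fix `t`. The characteristic function at `t` is that of the
    -- projection on `t` at `1`, so the scalar result applies.
    refine ProbabilityMeasure.tendsto_iff_tendsto_charFun.2 fun t => ?_
    rw! [hY.map_eq]
    have hsumLp (i : ℕ) :
        MemLp (fun ω => ∑ k, t k * X i ω k) (ENNReal.ofReal (2 + δ)) P :=
      memLp_finsetSum _ fun k _ => (hX i k).const_mul _
    have hprod (m : ℕ) :
        charFun (P.map fun ω => (1 / √(m : ℝ)) • ∑ i ∈ Finset.range m, X i ω) t =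
        ∏ i ∈ Finset.range m,
          ∫ ω, Complex.exp ((1 / √(m : ℝ) * ∑ k, t k * X i ω k : ℝ) * Complex.I) ∂P := by
      have hmap : (P.map fun ω => (1 / √(m : ℝ)) • ∑ i ∈ Finset.range m, X i ω) =
          (P.map fun ω => ∑ i ∈ Finset.range m, X i ω).map fun x => (1 / √(m : ℝ)) • x :=
        (AEMeasurable.map_map_of_aemeasurable (by fun_prop)
          (Finset.aemeasurable_fun_sum _ fun i _ => hmeas i)).symm
      rw [hmap, charFun_map_smul,
        (hindep.restrict _).charFun_map_fun_finsetSum_eq_prod fun i _ => hmeas i, Finset.prod_apply]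
      refine Finset.prod_congr rfl fun i _ => ?_
      rw [charFun_apply, integral_map (hmeas i) (by fun_prop)]
      simp [inner_smul_right, PiLp.inner_apply]
    have hlim : charFun (multivariateGaussian 0 S) t =
        (Real.exp (-((t.ofLp ⬝ᵥ S *ᵥ t.ofLp) / 2)) : ℝ) := by
      rw [charFun_multivariateGaussian hpos]
      simp
    change Tendsto
      (fun m : ℕ => charFun (P.map fun ω => (1 / √(m : ℝ)) • ∑ i ∈ Finset.range m, X i ω) t) atTop
      (𝓝 (charFun (multivariateGaussian 0 S) t))
    rw [hlim]
    refine Tendsto.congr (fun m => (hprod m).symm) ?_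
    refine tendsto_prod_integral_exp_mul_I (X := fun m i ω => 1 / √(m : ℝ) * ∑ k, t k * X i ω k) hδ
      (fun m i => ((hsumLp i).const_mul _).aestronglyMeasurable)
      (fun m i => integrable_abs_rpow_of_memLp hr ((hsumLp i).const_mul _)) (fun m i => ?_)
      (tendsto_sum_integral_sum_mul_sq (X := fun i ω => (X i ω).ofLp) hX2 hS t)
      (tendsto_sum_integral_abs_sum_mul_rpow (X := fun i ω => (X i ω).ofLp) hδ hX hLyap t)
    rw [integral_const_mul,
      integral_finsetSum _ fun k _ => ((hX2 i k).integrable (by norm_num)).const_mul _]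
    simp [integral_const_mul, hmean]

end VectorCLT

/-! ### Averages of deterministic sequences. -/

section Averages

/-- A weighted Cesàro theorem: in an average, a convergent factor may be replaced by its limit. -/
lemma tendsto_average_mul {x w b : ℕ → ℝ} {γ W β : ℝ} (hxw : ∀ i, |x i| ≤ w i)
    (hx : Tendsto (fun m : ℕ => (1 / (m : ℝ)) * ∑ i ∈ Finset.range m, x i) atTop (𝓝 γ))
    (hw : Tendsto (fun m : ℕ => (1 / (m : ℝ)) * ∑ i ∈ Finset.range m, w i) atTop (𝓝 W))
    (hb : Tendsto b atTop (𝓝 β)) :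
    Tendsto (fun m : ℕ => (1 / (m : ℝ)) * ∑ i ∈ Finset.range m, x i * b i) atTop (𝓝 (γ * β)) := by
  have hw0 (i : ℕ) : 0 ≤ w i := (abs_nonneg _).trans (hxw i)
  -- The comparison weight is `w i + 1` because its partial sums always diverge, as summing a
  -- little-o relation requires; those of `w` might stay bounded.
  have hO : x =O[atTop] fun i => w i + 1 :=
    .of_bound 1 <| .of_forall fun i => by
      rw [Real.norm_eq_abs, Real.norm_eq_abs, abs_of_nonneg (a := w i + 1) (by linarith [hw0 i]),
        one_mul]
      linarith [hxw i]
  have ho : (fun i => x i * (b i - β)) =o[atTop] fun i => w i + 1 := by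
    have : (fun i => b i - β) =o[atTop] fun _ => (1 : ℝ) :=
      (Asymptotics.isLittleO_one_iff ℝ).2 (by simpa using hb.sub_const β)
    simpa using hO.mul_isLittleO this
  have hdiv : Tendsto (fun m : ℕ => ∑ i ∈ Finset.range m, (w i + 1)) atTop atTop := by
    refine tendsto_atTop_mono (fun m => ?_) tendsto_natCast_atTop_atTop
    rw [Finset.sum_add_distrib]
    simpa using Finset.sum_nonneg fun i (_ : i ∈ Finset.range m) => hw0 i
  have hsum := ho.sum_range (fun i => by positivity [hw0 i]) hdiv
  have hO1 : (fun m : ℕ => (1 / (m : ℝ)) * ∑ i ∈ Finset.range m, (w i + 1)) =O[atTop]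
      fun _ => (1 : ℝ) := by
    have h1 : Tendsto (fun m : ℕ => (1 / (m : ℝ)) * ∑ i ∈ Finset.range m, (1 : ℝ)) atTop
        (𝓝 1) := by
      simpa using (tendsto_const_nhds (x := (1 : ℝ))).cesaro
    refine (hw.add h1).isBigO_one ℝ |>.congr_left fun m => ?_
    rw [Finset.sum_add_distrib, mul_add]
  have h0 : Tendsto (fun m : ℕ => (1 / (m : ℝ)) * ∑ i ∈ Finset.range m, x i * (b i - β)) atTop
      (𝓝 0) :=
    (Asymptotics.isLittleO_one_iff ℝ).1
      (((Asymptotics.isBigO_refl (fun m : ℕ => 1 / (m : ℝ)) atTop).mul_isLittleO hsum).trans_isBigO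
        hO1)
  convert! h0.add (hx.mul_const β) using 2 with m
  · rw [mul_assoc, ← mul_add, Finset.sum_mul, ← Finset.sum_add_distrib]
    congr 1
    exact Finset.sum_congr rfl fun i _ => by ring
  · ring

/-- The sum is at most `m * C`, which leaves `C * m ^ (-(δ / 2))`. -/
lemma tendsto_one_div_rpow_mul_sum_of_le {δ C : ℝ} (hδ : 0 < δ) {x : ℕ → ℝ} (hx : ∀ i, 0 ≤ x i)
    (hxC : ∀ i, x i ≤ C) :
    Tendsto (fun m : ℕ => (1 / (m : ℝ) ^ (1 + δ / 2)) * ∑ i ∈ Finset.range m, x i) atTop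
      (𝓝 0) := by
  have hlim : Tendsto (fun m : ℕ => C * (m : ℝ) ^ (-(δ / 2))) atTop (𝓝 0) := by
    simpa using ((tendsto_rpow_neg_atTop (by positivity : 0 < δ / 2)).comp
      tendsto_natCast_atTop_atTop).const_mul C
  refine squeeze_zero' (.of_forall fun m => ?_) ?_ hlim
  · exact mul_nonneg (by positivity) (Finset.sum_nonneg fun i _ => hx i)
  · filter_upwards [eventually_gt_atTop 0] with m hm
    have hm' : (0 : ℝ) < m := by exact_mod_cast hm
    calc _ ≤ (1 / (m : ℝ) ^ (1 + δ / 2)) * (m * C) := by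
          gcongr
          simpa using Finset.sum_le_sum fun i (_ : i ∈ Finset.range m) => hxC i
      _ = _ := by
        rw [Real.rpow_neg hm'.le, Real.rpow_add hm', Real.rpow_one]
        field_simp

lemma tendsto_average_mul_input {n : ℕ} {a₀ : ℕ → EuclideanSpace ℝ (Fin n)}
    {VA : Matrix (Fin n) (Fin n) ℝ}
    (h_VA : Tendsto (fun m : ℕ =>
        (1 / (m : ℝ)) • ((inputMatrix a₀ m)ᵀ * inputMatrix a₀ m)) atTop (𝓝 VA)) (j k : Fin n) :
    Tendsto (fun m : ℕ => (1 / (m : ℝ)) * ∑ i ∈ Finset.range m, a₀ i j * a₀ i k) atTop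
      (𝓝 (VA j k)) := by
  have h := ((continuous_id.matrix_elem j k).tendsto VA).comp h_VA
  refine h.congr fun m => ?_
  simp only [Function.comp_apply, id, Matrix.smul_apply, Matrix.mul_apply, inputMatrix,
    Matrix.transpose_apply, Matrix.of_apply, smul_eq_mul]
  rw [Fin.sum_univ_eq_sum_range fun i => a₀ i j * a₀ i k]

end Averages

/-! ### Moment bounds for products. -/

section Moments

variable {Ω : Type*} [MeasurableSpace Ω] {P : Measure Ω} [IsProbabilityMeasure P]

lemma abs_rpow_le_one_add_abs_rpow {r s : ℝ} (hr : 0 < r) (hrs : r ≤ s) (x : ℝ) :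
    |x| ^ r ≤ 1 + |x| ^ s := by
  rcases le_or_gt |x| 1 with h | h
  · have := Real.rpow_le_one (abs_nonneg x) h hr.le
    have : 0 ≤ |x| ^ s := by positivity
    linarith
  · have := Real.rpow_le_rpow_of_exponent_le h.le hrs
    linarith

lemma integral_abs_rpow_le_one_add {r s K : ℝ} (hr : 0 < r) (hrs : r ≤ s) {X : Ω → ℝ}
    (hs : Integrable (fun ω => |X ω| ^ s) P) (hK : ∫ ω, |X ω| ^ s ∂P ≤ K) :
    ∫ ω, |X ω| ^ r ∂P ≤ 1 + K := by
  calc _ ≤ ∫ ω, (1 + |X ω| ^ s) ∂P :=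
        integral_mono_of_nonneg (ae_of_all _ fun ω => by positivity) ((integrable_const _).add hs)
          (ae_of_all _ fun ω => abs_rpow_le_one_add_abs_rpow hr hrs _)
    _ ≤ _ := by
      rw [integral_add (integrable_const _) hs]
      simpa using hK

/-- Since `4 + 2δ = 2 (2 + δ)`, this is `a b ≤ a² + b²` for nonnegative `a`, `b`; it explains the
order of the assumed error moments. -/
lemma abs_mul_rpow_le_add {δ : ℝ} (x y : ℝ) :
    |x * y| ^ (2 + δ) ≤ |x| ^ (4 + 2 * δ) + |y| ^ (4 + 2 * δ) := by
  have h (z : ℝ) : |z| ^ (4 + 2 * δ) = (|z| ^ (2 + δ)) ^ 2 := by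
    rw [← Real.rpow_two, ← Real.rpow_mul (abs_nonneg z)]
    congr 1; ring
  rw [h, h, abs_mul, Real.mul_rpow (abs_nonneg _) (abs_nonneg _)]
  nlinarith [sq_nonneg (|x| ^ (2 + δ) - |y| ^ (2 + δ)), sq_nonneg (|x| ^ (2 + δ) + |y| ^ (2 + δ))]

variable {δ K : ℝ} {X Y : Ω → ℝ}

omit [IsProbabilityMeasure P] in
lemma integrable_abs_mul_rpow (hX : AEStronglyMeasurable X P) (hY : AEStronglyMeasurable Y P)
    (hXi : Integrable (fun ω => |X ω| ^ (4 + 2 * δ)) P)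
    (hYi : Integrable (fun ω => |Y ω| ^ (4 + 2 * δ)) P) (hδ : 0 < δ) :
    Integrable (fun ω => |X ω * Y ω| ^ (2 + δ)) P := by
  refine (hXi.add hYi).mono' ?_ (ae_of_all _ fun ω => ?_)
  · exact ((Real.continuous_rpow_const (by linarith : 0 ≤ 2 + δ)).comp
      continuous_abs).comp_aestronglyMeasurable (hX.mul hY)
  · rw [Real.norm_of_nonneg (by positivity)]
    exact abs_mul_rpow_le_add _ _

/-- A centered product of two variables has a `2 + δ` moment controlled by the `4 + 2δ` moments of
the factors. -/
lemma integral_abs_mul_sub_rpow_le (hδ : 0 < δ) (hX : AEStronglyMeasurable X P)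
    (hY : AEStronglyMeasurable Y P) (hXi : Integrable (fun ω => |X ω| ^ (4 + 2 * δ)) P)
    (hYi : Integrable (fun ω => |Y ω| ^ (4 + 2 * δ)) P)
    (hXK : ∫ ω, |X ω| ^ (4 + 2 * δ) ∂P ≤ K) (hYK : ∫ ω, |Y ω| ^ (4 + 2 * δ) ∂P ≤ K) :
    ∫ ω, |X ω * Y ω - ∫ ω, X ω * Y ω ∂P| ^ (2 + δ) ∂P ≤
      2 ^ (1 + δ) * (2 * K + (1 + 2 * K) ^ (2 + δ)) := by
  have hr : 0 < 2 + δ := by linarith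
  have hXY := integrable_abs_mul_rpow hX hY hXi hYi hδ
  have hXYK : ∫ ω, |X ω * Y ω| ^ (2 + δ) ∂P ≤ 2 * K := by
    calc _ ≤ ∫ ω, (|X ω| ^ (4 + 2 * δ) + |Y ω| ^ (4 + 2 * δ)) ∂P :=
          integral_mono hXY (hXi.add hYi) fun ω => abs_mul_rpow_le_add _ _
      _ ≤ _ := by rw [integral_add hXi hYi]; linarith
  set e := ∫ ω, X ω * Y ω ∂P with he
  have hmean : |e| ≤ 1 + 2 * K := by
    refine (abs_integral_le_integral_abs).trans ?_
    simpa using integral_abs_rpow_le_one_add (r := 1) one_pos (by linarith) hXY hXYK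
  have hpt (ω : Ω) : |X ω * Y ω - e| ^ (2 + δ) ≤
      2 ^ (1 + δ) * (|X ω * Y ω| ^ (2 + δ) + (1 + 2 * K) ^ (2 + δ)) := by
    -- The difference is a two-term sum with coefficients `1` and `-1`, whence the constant `2 ^ (1
    -- + δ)`.
    have h := abs_sum_mul_rpow_le (ι := Fin 2) (r := 2 + δ) (by linarith) ![1, -1] ![X ω * Y ω, e]
    simp only [Fin.sum_univ_two, Matrix.cons_val_zero, Matrix.cons_val_one, Fintype.card_fin,
      abs_neg, abs_one, Real.one_rpow, one_mul, neg_mul, ← sub_eq_add_neg] at h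
    rw [show 2 + δ - 1 = 1 + δ by ring] at h
    refine h.trans ?_
    push_cast
    gcongr
  calc _ ≤ ∫ ω, 2 ^ (1 + δ) * (|X ω * Y ω| ^ (2 + δ) + (1 + 2 * K) ^ (2 + δ)) ∂P :=
        integral_mono_of_nonneg (ae_of_all _ fun ω => by positivity)
          ((hXY.add (integrable_const _)).const_mul _) (ae_of_all _ hpt)
    _ ≤ _ := by
      rw [integral_const_mul, integral_add hXY (integrable_const _)]
      simp only [integral_const, probReal_univ, one_smul]
      gcongr

end Moments

/-! ### Couples of matrices as Euclidean vectors. -/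

section Vectorization

/-- The entries of a couple of matrices, as a Euclidean vector space. -/
abbrev PairSpace (n N : ℕ) : Type := EuclideanSpace ℝ ((Fin n × Fin N) ⊕ (Fin N × Fin N))

/-- The continuous linear map rebuilding a couple of matrices from its entries. -/
noncomputable def pairOfEntries (n N : ℕ) :
    PairSpace n N →L[ℝ] Matrix (Fin n) (Fin N) ℝ × Matrix (Fin N) (Fin N) ℝ :=
  LinearMap.toContinuousLinearMap
    { toFun := fun x =>
        (Matrix.of fun j k => x (Sum.inl (j, k)), Matrix.of fun p q => x (Sum.inr (p, q)))
      map_add' := fun _ _ => rfl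
      map_smul' := fun _ _ => rfl }

lemma pairOfEntries_apply {n N : ℕ} (x : PairSpace n N) :
    pairOfEntries n N x =
      (Matrix.of fun j k => x (Sum.inl (j, k)), Matrix.of fun p q => x (Sum.inr (p, q))) := rfl

/-- The entries of `(a cᵀ, c cᵀ - M)`. -/
noncomputable def pairEntries {n N : ℕ} (a : Fin n → ℝ) (M : Fin N → Fin N → ℝ)
    (c : Fin N → ℝ) : PairSpace n N :=
  WithLp.toLp 2 (Sum.elim (fun jk => a jk.1 * c jk.2) fun pq => c pq.1 * c pq.2 - M pq.1 pq.2)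

@[simp]
lemma pairEntries_inl {n N : ℕ} (a : Fin n → ℝ) (M : Fin N → Fin N → ℝ) (c : Fin N → ℝ)
    (jk : Fin n × Fin N) : pairEntries a M c (Sum.inl jk) = a jk.1 * c jk.2 := rfl

@[simp]
lemma pairEntries_inr {n N : ℕ} (a : Fin n → ℝ) (M : Fin N → Fin N → ℝ) (c : Fin N → ℝ)
    (pq : Fin N × Fin N) :
    pairEntries a M c (Sum.inr pq) = c pq.1 * c pq.2 - M pq.1 pq.2 := rfl

lemma measurable_pairEntries {n N : ℕ} (a : Fin n → ℝ) (M : Fin N → Fin N → ℝ) :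
    Measurable (pairEntries a M) := by
  have hcoord (p : Fin N) : Measurable fun c : Fin N → ℝ => c p := measurable_pi_apply p
  refine (WithLp.measurable_toLp 2 _).comp (measurable_pi_lambda _ ?_)
  rintro (jk | pq)
  · exact (hcoord jk.2).const_mul _
  · exact ((hcoord pq.1).mul (hcoord pq.2)).sub_const _

/-- Centering by `E c_p c_q` agrees with subtracting `σ² Sᵢ`: the means vanish, so covariances are
second moments, and the factor `σ²` cancels. -/
lemma pairOfEntries_pairEntries {Ω : Type*} [MeasurableSpace Ω] {P : Measure Ω}
    [IsProbabilityMeasure P] {n N : ℕ} {σ : ℝ} (hσ : σ ≠ 0) (a₀ : ℕ → EuclideanSpace ℝ (Fin n))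
    {c : ℕ → Ω → Fin N → ℝ} (hc_sq : ∀ i j, MemLp (fun ω => c i ω j) 2 P)
    (hc_mean : ∀ i j, ∫ ω, c i ω j ∂P = 0) (i : ℕ) (ω : Ω) :
    pairOfEntries n N (pairEntries (a₀ i) (fun p q => ∫ ω, c i ω p * c i ω q ∂P) (c i ω)) =
      pairW P σ a₀ c i ω := by
  have hcov (p q : Fin N) : σ ^ 2 * normCov P σ c i p q = ∫ ω, c i ω p * c i ω q ∂P := by
    simp only [normCov, covMatrix, Matrix.smul_apply, Matrix.of_apply, smul_eq_mul]
    rw [covariance_eq_sub (hc_sq i p) (hc_sq i q), hc_mean, hc_mean]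
    field_simp
    simp
  refine Prod.ext ?_ ?_
  · ext j k
    simp [pairOfEntries_apply, pairW, Matrix.vecMulVec_apply]
  · ext p q
    simp [pairOfEntries_apply, pairW, Matrix.vecMulVec_apply, hcov]

/-- If the two blocks of entries are uncorrelated, then a Gaussian couple of matrices has
independent components. -/
lemma indepFun_pairOfEntries {n N : ℕ} {S : Matrix ((Fin n × Fin N) ⊕ (Fin N × Fin N)) _ ℝ}
    (hS : S.PosSemidef) (h0 : ∀ jk pq, S (Sum.inl jk) (Sum.inr pq) = 0) :
    IndepFun (fun x => (pairOfEntries n N x).1) (fun x => (pairOfEntries n N x).2)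
      (multivariateGaussian 0 S) := by
  let blocks : PairSpace n N →L[ℝ] (Fin n × Fin N → ℝ) × (Fin N × Fin N → ℝ) :=
    LinearMap.toContinuousLinearMap
      { toFun := fun x => (fun jk => x (Sum.inl jk), fun pq => x (Sum.inr pq))
        map_add' := fun _ _ => rfl
        map_smul' := fun _ _ => rfl }
  have hgauss : HasGaussianLaw
      (fun x : PairSpace n N => (fun jk => x (Sum.inl jk), fun pq => x (Sum.inr pq)))
      (multivariateGaussian 0 S) :=
    IsGaussian.hasGaussianLaw_id.map_of_measurable blocks blocks.continuous.measurable
  have hind := hgauss.indepFun_of_covariance_eval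
    (X := fun jk (x : PairSpace n N) => x (Sum.inl jk))
    (Y := fun pq (x : PairSpace n N) => x (Sum.inr pq)) fun jk pq => by
      rw [covariance_eval_multivariateGaussian hS, h0]
  have hcurry {ι κ : Type} [Fintype ι] [Fintype κ] :
      Measurable fun y : ι × κ → ℝ => (Matrix.of fun j k => y (j, k) : Matrix ι κ ℝ) :=
    measurable_pi_lambda _ fun j => measurable_pi_lambda _ fun k => measurable_pi_apply (j, k)
  exact hind.comp hcurry hcurry

end Vectorization

/-! ### Extending the moment assumptions from `J` to all coordinates. -/

section ErrorMoments

variable {Ω : Type*} [MeasurableSpace Ω] {P : Measure Ω} {N : ℕ}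

lemma ae_eq_zero_of_integral_sq_eq_zero {X : Ω → ℝ} (hX : MemLp X 2 P)
    (h : ∫ ω, X ω ^ 2 ∂P = 0) : X =ᵐ[P] 0 := by
  have := (integral_eq_zero_iff_of_nonneg (fun ω => sq_nonneg (X ω)) hX.integrable_sq).1 h
  filter_upwards [this] with ω hω
  simpa using hω

/-- The moment bound extends to the error-free coordinates. -/
lemma exists_moment_bound {J : Finset (Fin N)} {c : ℕ → Ω → Fin N → ℝ} {r : ℝ} (hr : 0 < r)
    (hzero : ∀ i, ∀ j ∉ J, (fun ω => c i ω j) =ᵐ[P] 0)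
    (h_mom : ∃ K : ℝ, ∀ i, ∀ j ∈ J,
      Integrable (fun ω => |c i ω j| ^ r) P ∧ ∫ ω, |c i ω j| ^ r ∂P ≤ K) :
    ∃ K : ℝ, ∀ i j,
      Integrable (fun ω => |c i ω j| ^ r) P ∧ ∫ ω, |c i ω j| ^ r ∂P ≤ K := by
  obtain ⟨K, hK⟩ := h_mom
  -- If `J` is empty nothing prevents `K < 0`, whereas error-free coordinates need a nonnegative
  -- bound.
  refine ⟨max K 0, fun i j => ?_⟩
  by_cases hj : j ∈ J
  · exact ⟨(hK i j hj).1, (hK i j hj).2.trans (le_max_left _ _)⟩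
  · have h0 : (fun ω => |c i ω j| ^ r) =ᵐ[P] fun _ => 0 := by
      filter_upwards [hzero i j hj] with ω hω
      simp only [Pi.zero_apply] at hω
      simp [hω, Real.zero_rpow hr.ne']
    exact ⟨(integrable_zero _ _ _).congr h0.symm, by rw [integral_congr_ae h0]; simp⟩

lemma exists_tendsto_integral_mul [IsProbabilityMeasure P] {J : Finset (Fin N)}
    {c : ℕ → Ω → Fin N → ℝ} {σ : ℝ}
    {Sig : ℕ → Matrix J J ℝ} {SigInf : Matrix J J ℝ}
    (hc_sq : ∀ i j, MemLp (fun ω => c i ω j) 2 P) (hc_mean : ∀ i j, ∫ ω, c i ω j ∂P = 0)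
    (hzero : ∀ i, ∀ j ∉ J, (fun ω => c i ω j) =ᵐ[P] 0)
    (hSig : ∀ i, covMatrix P (fun ω (j : J) => c i ω j) = σ ^ 2 • Sig i)
    (h_Sig : Tendsto Sig atTop (𝓝 SigInf)) (p q : Fin N) :
    ∃ s, Tendsto (fun i => ∫ ω, c i ω p * c i ω q ∂P) atTop (𝓝 s) := by
  by_cases hp : p ∈ J
  · by_cases hq : q ∈ J
    · have h := (((continuous_id.matrix_elem (⟨p, hp⟩ : J) (⟨q, hq⟩ : J)).tendsto SigInf).comp
        h_Sig).const_mul (σ ^ 2)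
      refine ⟨_, h.congr fun i => ?_⟩
      have hi := congrFun₂ (hSig i) ⟨p, hp⟩ ⟨q, hq⟩
      simp only [covMatrix, Matrix.of_apply, Matrix.smul_apply, smul_eq_mul] at hi
      rw [covariance_eq_sub (hc_sq i p) (hc_sq i q), hc_mean, hc_mean] at hi
      simpa using hi.symm
    · refine ⟨0, tendsto_const_nhds.congr fun i => (integral_eq_zero_of_ae ?_).symm⟩
      filter_upwards [hzero i q hq] with ω hω
      simp only [Pi.zero_apply] at hω
      simp [hω]
  · refine ⟨0, tendsto_const_nhds.congr fun i => (integral_eq_zero_of_ae ?_).symm⟩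
    filter_upwards [hzero i p hp] with ω hω
    simp only [Pi.zero_apply] at hω
    simp [hω]

lemma integral_mul_mul_eq_zero {J : Finset (Fin N)} {c : Ω → Fin N → ℝ}
    (hzero : ∀ j ∉ J, (fun ω => c ω j) =ᵐ[P] 0)
    (h : ∀ p ∈ J, ∀ q ∈ J, ∀ r ∈ J, ∫ ω, c ω p * c ω q * c ω r ∂P = 0) (p q r : Fin N) :
    ∫ ω, c ω p * c ω q * c ω r ∂P = 0 := by
  by_cases hall : p ∈ J ∧ q ∈ J ∧ r ∈ J
  · exact h p hall.1 q hall.2.1 r hall.2.2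
  · refine integral_eq_zero_of_ae ?_
    filter_upwards [ae_all_iff.2 fun j => ae_all_iff.2 fun hj => hzero j hj] with ω hω
    simp only [Pi.zero_apply] at hω
    by_cases hp : p ∈ J
    · by_cases hq : q ∈ J
      · simp [hω r fun hr => hall ⟨hp, hq, hr⟩]
      · simp [hω q hq]
    · simp [hω p hp]

lemma exists_tendsto_average_integral_mul {J : Finset (Fin N)} {c : ℕ → Ω → Fin N → ℝ}
    (hzero : ∀ i, ∀ j ∉ J, (fun ω => c i ω j) =ᵐ[P] 0)
    (h_fourth : ∀ p ∈ J, ∀ q ∈ J, ∀ r ∈ J, ∀ u ∈ J, ∃ μ₄ : ℝ,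
      Tendsto (fun m : ℕ => (1 / (m : ℝ)) *
          ∑ i ∈ Finset.range m, ∫ ω, c i ω p * c i ω q * c i ω r * c i ω u ∂P)
        atTop (𝓝 μ₄)) (p q r u : Fin N) :
    ∃ μ₄ : ℝ, Tendsto (fun m : ℕ => (1 / (m : ℝ)) *
        ∑ i ∈ Finset.range m, ∫ ω, c i ω p * c i ω q * c i ω r * c i ω u ∂P) atTop (𝓝 μ₄) := by
  by_cases hall : p ∈ J ∧ q ∈ J ∧ r ∈ J ∧ u ∈ J
  · exact h_fourth p hall.1 q hall.2.1 r hall.2.2.1 u hall.2.2.2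
  · have h0 (i : ℕ) : ∫ ω, c i ω p * c i ω q * c i ω r * c i ω u ∂P = 0 := by
      refine integral_eq_zero_of_ae ?_
      filter_upwards [ae_all_iff.2 fun j => ae_all_iff.2 fun hj => hzero i j hj] with ω hω
      simp only [Pi.zero_apply] at hω
      by_cases hp : p ∈ J
      · by_cases hq : q ∈ J
        · by_cases hr : r ∈ J
          · simp [hω u fun hu => hall ⟨hp, hq, hr, hu⟩]
          · simp [hω r hr]
        · simp [hω q hq]
      · simp [hω p hp]
    exact ⟨0, by simp [h0]⟩

/-- This makes the linear and quadratic blocks uncorrelated: `E[XYZ]` and `e E[X]` both vanish.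
Fourth moments serve only integrability, through Hölder with `1/4 + 1/4 = 1/2`. -/
lemma integral_mul_mul_sub [IsProbabilityMeasure P] {X Y Z : Ω → ℝ} (hX : MemLp X 4 P)
    (hY : MemLp Y 4 P) (hZ : MemLp Z 4 P) (hX0 : ∫ ω, X ω ∂P = 0)
    (hXYZ : ∫ ω, X ω * Y ω * Z ω ∂P = 0) (e : ℝ) :
    ∫ ω, X ω * (Y ω * Z ω - e) ∂P = 0 := by
  have : ENNReal.HolderTriple 4 4 2 := ⟨by
    rw [← ENNReal.toReal_eq_toReal_iff' (by simp) (by simp), ENNReal.toReal_add (by simp) (by simp)]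
    norm_num⟩
  have h2 : MemLp X 2 P := hX.mono_exponent (by norm_num)
  have hYZ : MemLp (Y * Z) 2 P := hZ.mul hY
  have hint : Integrable (fun ω => X ω * Y ω * Z ω) P :=
    (h2.integrable_mul hYZ).congr (ae_of_all _ fun ω => by simp [mul_assoc])
  have hXe : Integrable (fun ω => X ω * e) P := (h2.integrable (by norm_num)).mul_const e
  calc _ = ∫ ω, (X ω * Y ω * Z ω - X ω * e) ∂P := by
        congr with ω; ring
    _ = 0 := by rw [integral_sub hint hXe, integral_mul_const, hX0, hXYZ]; simp

lemma integral_mul_sub_mul_mul_sub [IsProbabilityMeasure P] {X Y Z U : Ω → ℝ}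
    (hX : MemLp X 4 P) (hY : MemLp Y 4 P) (hZ : MemLp Z 4 P) (hU : MemLp U 4 P) :
    ∫ ω, (X ω * Y ω - ∫ ω, X ω * Y ω ∂P) * (Z ω * U ω - ∫ ω, Z ω * U ω ∂P) ∂P =
      ∫ ω, X ω * Y ω * Z ω * U ω ∂P - (∫ ω, X ω * Y ω ∂P) * ∫ ω, Z ω * U ω ∂P := by
  have : ENNReal.HolderTriple 4 4 2 := ⟨by
    rw [← ENNReal.toReal_eq_toReal_iff' (by simp) (by simp), ENNReal.toReal_add (by simp) (by simp)]
    norm_num⟩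
  have hXY : MemLp (X * Y) 2 P := hY.mul hX
  have hZU : MemLp (Z * U) 2 P := hU.mul hZ
  have h := covariance_eq_sub hXY hZU
  simp only [covariance, Pi.mul_apply] at h
  rw [h]
  simp [mul_assoc]

end ErrorMoments

/-! ### The conditions of the central limit theorem for the vector of entries. -/

section Couple

variable {Ω : Type*} [MeasurableSpace Ω] {P : Measure Ω} [IsProbabilityMeasure P] {n N : ℕ}
  {a₀ : ℕ → EuclideanSpace ℝ (Fin n)} {c : ℕ → Ω → Fin N → ℝ}

/-- The averaged covariances of the entries converge, and those between the two blocks vanish. -/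
lemma exists_tendsto_average_covariance_pairEntries {VA : Matrix (Fin n) (Fin n) ℝ}
    (hc4 : ∀ i j, MemLp (fun ω => c i ω j) 4 P) (hc_mean : ∀ i j, ∫ ω, c i ω j ∂P = 0)
    (h_gram : ∀ j k, Tendsto (fun m : ℕ =>
      (1 / (m : ℝ)) * ∑ i ∈ Finset.range m, a₀ i j * a₀ i k) atTop (𝓝 (VA j k)))
    (h_second : ∀ p q, ∃ s, Tendsto (fun i => ∫ ω, c i ω p * c i ω q ∂P) atTop (𝓝 s))
    (h_third : ∀ i p q r, ∫ ω, c i ω p * c i ω q * c i ω r ∂P = 0)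
    (h_fourth : ∀ p q r u, ∃ μ₄ : ℝ, Tendsto (fun m : ℕ => (1 / (m : ℝ)) *
      ∑ i ∈ Finset.range m, ∫ ω, c i ω p * c i ω q * c i ω r * c i ω u ∂P) atTop (𝓝 μ₄)) :
    ∃ S : Matrix ((Fin n × Fin N) ⊕ (Fin N × Fin N)) ((Fin n × Fin N) ⊕ (Fin N × Fin N)) ℝ,
      (∀ jk pq, S (Sum.inl jk) (Sum.inr pq) = 0) ∧
      ∀ k l, Tendsto (fun m : ℕ => (1 / (m : ℝ)) * ∑ i ∈ Finset.range m,
        ∫ ω, pairEntries (a₀ i) (fun p q => ∫ ω, c i ω p * c i ω q ∂P) (c i ω) k *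
          pairEntries (a₀ i) (fun p q => ∫ ω, c i ω p * c i ω q ∂P) (c i ω) l ∂P)
        atTop (𝓝 (S k l)) := by
  choose s hs using h_second
  choose μ₄ hμ₄ using h_fourth
  have hcross (i : ℕ) (jk : Fin n × Fin N) (pq : Fin N × Fin N) :
      ∫ ω, a₀ i jk.1 * c i ω jk.2 * (c i ω pq.1 * c i ω pq.2 - ∫ ω, c i ω pq.1 * c i ω pq.2 ∂P) ∂P
        = 0 := by
    simp_rw [mul_assoc]
    rw [integral_const_mul,
      integral_mul_mul_sub (hc4 i _) (hc4 i _) (hc4 i _) (hc_mean i _) (h_third i _ _ _), mul_zero]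
  refine ⟨Matrix.of (Sum.elim
    (fun jp => Sum.elim (fun kq => VA jp.1 kq.1 * s jp.2 kq.2) fun _ => 0)
    (fun pq => Sum.elim (fun _ => 0)
      fun ru => μ₄ pq.1 pq.2 ru.1 ru.2 - s pq.1 pq.2 * s ru.1 ru.2)), fun _ _ => rfl, ?_⟩
  rintro (jp | pq) (kq | ru)
  · simp only [pairEntries_inl, Matrix.of_apply, Sum.elim_inl]
    -- The products `a₀ i j * a₀ i k` may change sign, so the weighted Cesàro argument needs a
    -- dominating weight with convergent averages. The sum of the two squares works, its averages
    -- being governed by diagonal Gram entries.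
    have hsq : Tendsto (fun m : ℕ => (1 / (m : ℝ)) *
        ∑ i ∈ Finset.range m, (a₀ i jp.1 * a₀ i jp.1 + a₀ i kq.1 * a₀ i kq.1)) atTop
        (𝓝 (VA jp.1 jp.1 + VA kq.1 kq.1)) := by
      simp_rw [Finset.sum_add_distrib, mul_add]
      exact (h_gram _ _).add (h_gram _ _)
    refine (tendsto_average_mul (fun i => ?_) (h_gram jp.1 kq.1) hsq (hs jp.2 kq.2)).congr
      fun m => ?_
    · rw [abs_le]
      constructor <;>
        nlinarith [sq_nonneg (a₀ i jp.1 - a₀ i kq.1), sq_nonneg (a₀ i jp.1 + a₀ i kq.1)]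
    · congr 1
      refine Finset.sum_congr rfl fun i _ => ?_
      rw [← integral_const_mul]
      congr with ω
      ring
  · simp [hcross]
  · simp [hcross, mul_comm (_ - _)]
  · simp only [pairEntries_inr, Matrix.of_apply, Sum.elim_inr]
    simp_rw [integral_mul_sub_mul_mul_sub (hc4 _ _) (hc4 _ _) (hc4 _ _) (hc4 _ _),
      Finset.sum_sub_distrib, mul_sub]
    refine (hμ₄ _ _ _ _).sub ?_
    simpa using ((hs pq.1 pq.2).mul (hs ru.1 ru.2)).cesaro

/-- The entries satisfy Lyapunov's condition. -/
lemma tendsto_lyapunov_pairEntries {δ K : ℝ} (hδ : 0 < δ)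
    (hc_meas : ∀ i j, AEStronglyMeasurable (fun ω => c i ω j) P)
    (hc : ∀ i j, Integrable (fun ω => |c i ω j| ^ (4 + 2 * δ)) P ∧
      ∫ ω, |c i ω j| ^ (4 + 2 * δ) ∂P ≤ K)
    (h_a : Tendsto (fun m : ℕ =>
        (1 / (m : ℝ) ^ (1 + δ / 2)) * ∑ i ∈ Finset.range m, ‖a₀ i‖ ^ (2 + δ)) atTop (𝓝 0))
    (k : (Fin n × Fin N) ⊕ (Fin N × Fin N)) :
    Tendsto (fun m : ℕ => (1 / (m : ℝ) ^ (1 + δ / 2)) * ∑ i ∈ Finset.range m,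
      ∫ ω, |pairEntries (a₀ i) (fun p q => ∫ ω, c i ω p * c i ω q ∂P) (c i ω) k| ^ (2 + δ) ∂P)
      atTop (𝓝 0) := by
  rcases k with jk | pq
  · refine squeeze_zero (fun m => mul_nonneg (by positivity)
      (Finset.sum_nonneg fun i _ => integral_nonneg fun ω => by positivity)) (fun m => ?_)
      (by simpa using h_a.const_mul (1 + K))
    -- The factor `1 + K` bounds the error moments of order `2 + δ` through those of order `4 + 2δ`;
    -- each input coordinate is at most the norm.
    calc _ ≤ (1 / (m : ℝ) ^ (1 + δ / 2)) *
          ∑ i ∈ Finset.range m, (1 + K) * ‖a₀ i‖ ^ (2 + δ) := by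
          gcongr with i
          simp_rw [pairEntries_inl, abs_mul, Real.mul_rpow (abs_nonneg _) (abs_nonneg _)]
          rw [integral_const_mul, mul_comm (1 + K)]
          refine mul_le_mul ?_ (integral_abs_rpow_le_one_add (by linarith) (by linarith)
            (hc i _).1 (hc i _).2) (integral_nonneg fun ω => by positivity) (by positivity)
          exact Real.rpow_le_rpow (abs_nonneg _) (PiLp.norm_apply_le (a₀ i) jk.1) (by linarith)
      _ = _ := by rw [← Finset.mul_sum]; ring
  · exact tendsto_one_div_rpow_mul_sum_of_le hδ (fun i => integral_nonneg fun ω => by positivity)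
      fun i => integral_abs_mul_sub_rpow_le hδ (hc_meas i _) (hc_meas i _) (hc i _).1 (hc i _).1
        (hc i _).2 (hc i _).2

end Couple

/-! ### Assembly of the limit theorem. -/

theorem lemma6 {Ω : Type*} [MeasurableSpace Ω] (P : Measure Ω) [IsProbabilityMeasure P]
    (n d : ℕ)
    -- the nonrandom true inputs and the random error vectors
    (a₀ : ℕ → EuclideanSpace ℝ (Fin n))
    (c : ℕ → Ω → Fin (n + d) → ℝ)
    -- independent, centered errors with finite second moments
    (hc_meas : ∀ i, Measurable (c i))
    (hc_indep : iIndepFun c P)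
    (hc_sq : ∀ i j, MemLp (fun ω => c i ω j) 2 P)
    (hc_mean : ∀ i j, ∫ ω, c i ω j ∂P = 0)
    -- error-free columns and the covariance structure up to a scalar factor
    (J : Finset (Fin (n + d)))
    (σ : ℝ) (hσ : 0 < σ)
    (Sig : ℕ → Matrix J J ℝ)
    (hJ : ∀ i, ∀ j ∉ J, ∫ ω, (c i ω j) ^ 2 ∂P = 0)
    (hSig : ∀ i, covMatrix P (fun ω (j : J) => c i ω j) = σ ^ 2 • Sig i)
    -- uniformly bounded moments of order `4 + 2δ`
    (δ : ℝ) (hδ : 0 < δ)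
    (h_mom : ∃ K : ℝ, ∀ i, ∀ j ∈ J,
      Integrable (fun ω => |c i ω j| ^ (4 + 2 * δ)) P ∧
        ∫ ω, |c i ω j| ^ (4 + 2 * δ) ∂P ≤ K)
    -- negligibility of the inputs, with the same `δ`
    (h_a : Tendsto (fun m : ℕ =>
        (1 / (m : ℝ) ^ (1 + δ / 2)) * ∑ i ∈ Finset.range m, ‖a₀ i‖ ^ (2 + δ))
      atTop (𝓝 0))
    -- convergence of the averaged Gram matrices of the inputs
    (VA : Matrix (Fin n) (Fin n) ℝ) (hVA : IsUnit VA)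
    (h_VA : Tendsto (fun m : ℕ =>
        (1 / (m : ℝ)) • ((inputMatrix a₀ m)ᵀ * inputMatrix a₀ m))
      atTop (𝓝 VA))
    -- convergence of the error covariance structure
    (SigInf : Matrix J J ℝ) (h_Sig : Tendsto Sig atTop (𝓝 SigInf))
    -- vanishing third moments
    (h_third : ∀ i, ∀ p ∈ J, ∀ q ∈ J, ∀ r ∈ J, ∫ ω, c i ω p * c i ω q * c i ω r ∂P = 0)
    -- convergent averaged fourth moments
    (h_fourth : ∀ p ∈ J, ∀ q ∈ J, ∀ r ∈ J, ∀ u ∈ J, ∃ μ₄ : ℝ,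
      Tendsto (fun m : ℕ => (1 / (m : ℝ)) *
          ∑ i ∈ Finset.range m, ∫ ω, c i ω p * c i ω q * c i ω r * c i ω u ∂P)
        atTop (𝓝 μ₄)) :
    ∃ (Ω' : Type) (_ : MeasurableSpace Ω') (P' : Measure Ω') (_ : IsProbabilityMeasure P')
      (Γ₁ : Ω' → Matrix (Fin n) (Fin (n + d)) ℝ)
      (Γ₂ : Ω' → Matrix (Fin (n + d)) (Fin (n + d)) ℝ),
      HasGaussianLaw (fun ω' => (Γ₁ ω', Γ₂ ω')) P' ∧
      (∀ j k, ∫ ω', Γ₁ ω' j k ∂P' = 0) ∧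
      (∀ j k, ∫ ω', Γ₂ ω' j k ∂P' = 0) ∧
      IndepFun Γ₁ Γ₂ P' ∧
      TendstoInDistribution
        (fun (m : ℕ) ω => (1 / √(m : ℝ)) • ∑ i ∈ Finset.range m, pairW P σ a₀ c i ω)
        atTop (fun ω' => (Γ₁ ω', Γ₂ ω')) (fun _ => P) P' := by
  have hr : 0 < 4 + 2 * δ := by linarith
  have hzero (i : ℕ) (j : Fin (n + d)) (hj : j ∉ J) : (fun ω => c i ω j) =ᵐ[P] 0 :=
    ae_eq_zero_of_integral_sq_eq_zero (hc_sq i j) (hJ i j hj)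
  obtain ⟨K, hc⟩ := exists_moment_bound hr hzero h_mom
  have hmeas (i : ℕ) (j : Fin (n + d)) : AEStronglyMeasurable (fun ω => c i ω j) P :=
    (hc_sq i j).aestronglyMeasurable
  have hc4 (i : ℕ) (j : Fin (n + d)) : MemLp (fun ω => c i ω j) 4 P := by
    exact_mod_cast memLp_of_integrable_abs_rpow_of_le (k := 4) hr (by push_cast; linarith)
      (hmeas i j) (hc i j).1
  obtain ⟨S, hS0, hS⟩ := exists_tendsto_average_covariance_pairEntries hc4 hc_mean
    (tendsto_average_mul_input h_VA)
    (exists_tendsto_integral_mul hc_sq hc_mean hzero hSig h_Sig)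
    (fun i => integral_mul_mul_eq_zero (hzero i) (h_third i))
    (exists_tendsto_average_integral_mul hzero h_fourth)
  set X : ℕ → Ω → PairSpace n (n + d) := fun i ω =>
    pairEntries (a₀ i) (fun p q => ∫ ω, c i ω p * c i ω q ∂P) (c i ω) with hX
  have hr2 : 0 < 2 + δ := by linarith
  have hprod (i : ℕ) (p q : Fin (n + d)) :
      MemLp (fun ω => c i ω p * c i ω q) (ENNReal.ofReal (2 + δ)) P :=
    memLp_of_integrable_abs_rpow hr2 ((hmeas i p).mul (hmeas i q))
      (integrable_abs_mul_rpow (hmeas i p) (hmeas i q) (hc i p).1 (hc i q).1 hδ)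
  have hXLp (i : ℕ) (k) : MemLp (fun ω => X i ω k) (ENNReal.ofReal (2 + δ)) P := by
    rcases k with jk | pq
    · exact ((memLp_of_integrable_abs_rpow hr (hmeas i _) (hc i _).1).mono_exponent
        (ENNReal.ofReal_le_ofReal (by linarith))).const_mul _
    · exact (hprod i _ _).sub (memLp_const _)
  have hXmean (i : ℕ) (k) : ∫ ω, X i ω k ∂P = 0 := by
    rcases k with jk | pq
    · simp [hX, integral_const_mul, hc_mean]
    · simp only [hX, pairEntries_inr]
      rw [integral_sub ((hprod i _ _).integrable (by
        rw [← ENNReal.ofReal_one]; exact ENNReal.ofReal_le_ofReal (by linarith)))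
        (integrable_const _)]
      simp
  have hXmeas (i : ℕ) : AEMeasurable (X i) P :=
    ((measurable_pairEntries _ _).comp (hc_meas i)).aemeasurable
  have hXindep : iIndepFun X P :=
    hc_indep.comp (fun i => pairEntries (a₀ i) fun p q => ∫ ω, c i ω p * c i ω q ∂P)
      fun i => measurable_pairEntries _ _
  have hpos : S.PosSemidef := posSemidef_of_tendsto_average (X := fun i ω => (X i ω).ofLp)
    (fun i k => (hXLp i k).mono_exponent (by
      rw [← ENNReal.ofReal_ofNat]; exact ENNReal.ofReal_le_ofReal (by linarith))) hS
  have hCLT := tendstoInDistribution_one_div_sqrt_smul_sum hδ hXindep hXmeas hXLp hXmean hS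
    (tendsto_lyapunov_pairEntries hδ hmeas hc h_a) (HasLaw.id (μ := multivariateGaussian 0 S))
  have hmean0 (k) : ∫ x : PairSpace n (n + d), x k ∂(multivariateGaussian 0 S) = 0 := by
    have h := (EuclideanSpace.proj k : PairSpace n (n + d) →L[ℝ] ℝ).integral_comp_comm
      (IsGaussian.integrable_id (μ := multivariateGaussian 0 S))
    simpa using h
  -- The limit is realized canonically: the probability space is the space of entries under its
  -- Gaussian law, and the two matrices are read off from the entries.
  refine ⟨PairSpace n (n + d), inferInstance, multivariateGaussian 0 S, inferInstance,
    fun x => (pairOfEntries n (n + d) x).1, fun x => (pairOfEntries n (n + d) x).2,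
    ?_, fun j k => hmean0 _, fun j k => hmean0 _, indepFun_pairOfEntries hpos hS0, ?_⟩
  · exact IsGaussian.hasGaussianLaw_id.map_of_measurable (pairOfEntries n (n + d))
      (pairOfEntries n (n + d)).continuous.measurable
  -- Continuous mapping; linearity moves the rebuilding map inside the normalized sum.
  · have h := hCLT.continuous_comp (pairOfEntries n (n + d)).continuous
    refine h.congr (fun m => ae_of_all _ fun ω => ?_) (ae_of_all _ fun ω => rfl)
    simp only [Function.comp_apply, map_smul, map_sum, hX,
      pairOfEntries_pairEntries hσ.ne' a₀ hc_sq hc_mean]
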